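/- Write a permutation $\sigma\in S_n$ of $\{1,\dots,n\}$ as a word $\sigma_1\cdots\sigma_n$, and put $\mathrm{des}(\sigma)=|\{i<n:\sigma_i>\sigma_{i+1}\}|$ and $\mathrm{inv}(\sigma)=|\{(i,k): i<k,\ \sigma_i>\sigma_k\}|$. For $\tau\in S_j$, a $\tau$-match in $\sigma$ is a position $i$ with $i+j-1\le n$ such that the word $\sigma_i\sigma_{i+1}\cdots\sigma_{i+j-1}$ has the same relative order as $\tau$; let $\mathcal{NM}_n(\tau)$ be the set of $\sigma\in S_n$ with no $\tau$-match. For $j\ge 3$, $\tau\in S_j$ is called minimal overlapping if the smallest $i$ for which some $\sigma\in S_i$ has exactly two $\tau$-matches is $i=2j-1$. For permutation statistics $\mathrm{stat}_1,\dots,\mathrm{stat}_k$, permutations $\alpha,\beta\in S_j$ are called $(\mathrm{stat}_1,\dots,\mathrm{stat}_k)$-c-Wilf equivalent if for all $n\ge 1$ $$\sum_{\sigma\in\mathcal{NM}_n(\alpha)}\prod_{i=1}^k x_i^{\mathrm{stat}_i(\sigma)}=\sum_{\sigma\in\mathcal{NM}_n(\beta)}\prod_{i=1}^k x_i^{\mathrm{stat}_i(\sigma)}$$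 as polynomials in $x_1,\dots,x_k$. Let $[n]_q=1+q+\cdots+q^{n-1}$ and $[n]_q!=[1]_q[2]_q\cdots[n]_q$, with $[0]_q!=1$. **Theorem.** Let $j\ge 3$ and let $\alpha=\alpha_1\cdots\alpha_j$ and $\beta=\beta_1\cdots\beta_j$ be minimal overlapping permutations in $S_j$ such that $\alpha_1=\beta_1=1$, $\alpha_j=\beta_j$ and $\mathrm{des}(\alpha)=\mathrm{des}(\beta)$. Then $$\sum_{n\ge 0}\frac{t^n}{n!}\sum_{\sigma\in\mathcal{NM}_n(\alpha)}x^{\mathrm{des}(\sigma)}=\sum_{n\ge 0}\frac{t^n}{n!}\sum_{\sigma\in\mathcal{NM}_n(\beta)}x^{\mathrm{des}(\sigma)}$$ as formal power series in $t$, and $\alpha$ and $\beta$ are $\mathrm{des}$-c-Wilf equivalent. If in addition $\mathrm{inv}(\alpha)=\mathrm{inv}(\beta)$, then $$\sum_{n\ge 0}\frac{t^n}{[n]_q!}\sum_{\sigma\in\mathcal{NM}_n(\alpha)}x^{\mathrm{des}(\sigma)}q^{\mathrm{inv}(\sigma)}=\sum_{n\ge 0}\frac{t^n}{[n]_q!}\sum_{\sigma\in\mathcal{NM}_n(\beta)}x^{\mathrm{des}(\sigma)}q^{\mathrm{inv}(\sigma)},$$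 and $\alpha$ and $\beta$ are $(\mathrm{des},\mathrm{inv})$-c-Wilf equivalent. -/

import Mathlib

open scoped Nat

namespace CWilf

/-- `Des(σ)`: the positions `i` with `σ_i > σ_{i+1}`. Permutations of `{1,…,n}` are represented by
`Equiv.Perm (Fin n)`, so positions and values are shifted down by one. -/
def desSet {n : ℕ} (σ : Equiv.Perm (Fin n)) : Finset (Fin n) :=
  Finset.univ.filter fun i => ∃ h : (i : ℕ) + 1 < n, σ ⟨(i : ℕ) + 1, h⟩ < σ i

/-- The number of descents. -/
def des {n : ℕ} (σ : Equiv.Perm (Fin n)) : ℕ := (desSet σ).card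

/-- The number of inversions. -/
def inv {n : ℕ} (σ : Equiv.Perm (Fin n)) : ℕ :=
  (Finset.univ.filter fun p : Fin n × Fin n => p.1 < p.2 ∧ σ p.2 < σ p.1).card

/-- The reduction of a word with distinct letters: each letter is replaced by its rank among the
letters of the word (the smallest letter has rank `0`). -/
def red {m n : ℕ} (w : Fin m → Fin n) (k : Fin m) : ℕ :=
  (Finset.univ.filter fun l => w l < w k).card

/-- There is a `τ`-match in `σ` starting in position `i`: the word
`σ_i σ_{i+1} … σ_{i+j-1}` exists and its reduction is `τ`. -/
def IsMatchAt {j n : ℕ} (τ : Equiv.Perm (Fin j)) (σ : Equiv.Perm (Fin n)) (i : ℕ) : Prop :=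
  ∃ h : i + j ≤ n, ∀ k : Fin j,
    red (fun l : Fin j => σ ⟨i + (l : ℕ), by omega⟩) k = (τ k : ℕ)

instance {j n : ℕ} (τ : Equiv.Perm (Fin j)) (σ : Equiv.Perm (Fin n)) (i : ℕ) :
    Decidable (IsMatchAt τ σ i) := by
  unfold IsMatchAt; infer_instance

/-- The number of `τ`-matches of `σ`. -/
def mch {j n : ℕ} (τ : Equiv.Perm (Fin j)) (σ : Equiv.Perm (Fin n)) : ℕ :=
  ((Finset.range n).filter fun i => IsMatchAt τ σ i).card

/-- The set of permutations of length `n` without `τ`-matches. -/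
def NM {j : ℕ} (n : ℕ) (τ : Equiv.Perm (Fin j)) : Finset (Equiv.Perm (Fin n)) :=
  Finset.univ.filter fun σ => mch τ σ = 0

/-- The minimal overlapping property of `τ ∈ S_j`, `j ≥ 3`: the smallest length of a permutation
with exactly two `τ`-matches is `2j - 1`. -/
def MinimalOverlapping {j : ℕ} (τ : Equiv.Perm (Fin j)) : Prop :=
  3 ≤ j ∧ IsLeast {i : ℕ | ∃ σ : Equiv.Perm (Fin i), mch τ σ = 2} (2 * j - 1)

/-- A permutation statistic, defined on permutations of every length. -/
abbrev PermStat : Type := ∀ n : ℕ, Equiv.Perm (Fin n) → ℕ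

/-- `α` and `β` are `(stat_1,…,stat_k)`-c-Wilf equivalent. -/
def StatCWilfEquiv {j k : ℕ} (stat : Fin k → PermStat) (α β : Equiv.Perm (Fin j)) : Prop :=
  ∀ n : ℕ, 1 ≤ n →
    (∑ σ ∈ NM n α, ∏ i : Fin k, (MvPolynomial.X i : MvPolynomial (Fin k) ℤ) ^ stat i n σ) =
      ∑ σ ∈ NM n β, ∏ i : Fin k, (MvPolynomial.X i : MvPolynomial (Fin k) ℤ) ^ stat i n σ

/-- `des` as a permutation statistic. -/
def desStat : PermStat := fun _ σ => des σ

/-- `inv` as a permutation statistic. -/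
def invStat : PermStat := fun _ σ => inv σ

/-- `[n]_q = 1 + q + ⋯ + q^{n-1}`. -/
def qNat {R : Type*} [CommRing R] (q : R) (n : ℕ) : R := ∑ i ∈ Finset.range n, q ^ i

/-- `[n]_q! = [1]_q [2]_q ⋯ [n]_q`. -/
def qFactorial {R : Type*} [CommRing R] (q : R) (n : ℕ) : R :=
  ∏ i ∈ Finset.range n, qNat q (i + 1)

/-- `∑_{n ≥ 0} t^n / n! ∑_{σ ∈ NM_n(τ)} x^{des σ}`, a power series in `t` over `ℚ[x]`. -/
noncomputable def desEGF {j : ℕ} (τ : Equiv.Perm (Fin j)) : PowerSeries (Polynomial ℚ) :=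
  PowerSeries.mk fun n =>
    Polynomial.C ((n ! : ℚ)⁻¹) * ∑ σ ∈ NM n τ, (Polynomial.X : Polynomial ℚ) ^ des σ

/-- `∑_{n ≥ 0} t^n / [n]_q! ∑_{σ ∈ NM_n(τ)} x^{des σ} q^{inv σ}`, a power series in `t` over
`ℚ(q)[x]`; the indeterminate `q` is `RatFunc.X`. -/
noncomputable def desInvQEGF {j : ℕ} (τ : Equiv.Perm (Fin j)) :
    PowerSeries (Polynomial (RatFunc ℚ)) :=
  PowerSeries.mk fun n =>
    Polynomial.C ((qFactorial (RatFunc.X : RatFunc ℚ) n)⁻¹) *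
      ∑ σ ∈ NM n τ, (Polynomial.X : Polynomial (RatFunc ℚ)) ^ des σ *
        Polynomial.C ((RatFunc.X : RatFunc ℚ) ^ inv σ)

end CWilf

/-!
Inclusion–exclusion over sets `S` of marked positions expresses a weighted sum over `NM n τ` through
the weighted sums over the permutations having a `τ`-match at every position of `S`. Two matches of
a minimal overlapping `τ` share at most one letter, which is then the last letter of one match and
the first letter of the other. So if `α` and `β` have the same first and last letters, the marked
matches of `α` can be turned into matches of `β` one after the other: rearranging the interior of
one match leaves the other marked matches intact. A rearrangement of this kind changes `des` and
`inv` only inside the match, namely by `des β - des α` and `inv β - inv α`.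
-/

namespace CWilf

open Finset Equiv

variable {j m n : ℕ}

section Reduction

lemma red_lt_red_iff {w : Fin m → Fin n} {k l : Fin m} : red w k < red w l ↔ w k < w l := by
  refine ⟨fun h => lt_of_not_ge fun hle => h.not_ge ?_, fun h => ?_⟩
  · exact card_le_card (monotone_filter_right _ fun a _ ha => ha.trans_le hle)
  · refine card_lt_card ((ssubset_iff_of_subset ?_).mpr ⟨k, by simpa using h, by simp⟩)
    exact monotone_filter_right _ fun a _ ha => ha.trans h

lemma red_eq_of_lt_iff {w : Fin m → Fin n} {τ : Perm (Fin m)}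
    (h : ∀ k l, w k < w l ↔ τ k < τ l) (k : Fin m) : red w k = τ k := by
  calc red w k = #{l | τ l < τ k} := by simp only [red, h]
    _ = #(Iio (τ k)) := card_equiv τ (by simp)
    _ = τ k := Fin.card_Iio _

end Reduction

section Blocks

/-- The inclusion of the block of positions `i, …, i + j - 1` into the positions of a word of length
`n`. -/
def blockEmb {i : ℕ} (h : i + j ≤ n) : Fin j ↪o Fin n :=
  (Fin.natAddOrderEmb i).trans (Fin.castLEOrderEmb h)

@[simp]
lemma coe_blockEmb {i : ℕ} (h : i + j ≤ n) (k : Fin j) : (blockEmb h k : ℕ) = i + k := rfl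

/-- The set of positions `i, …, i + j - 1` of a word of length `n`. -/
def block (n i j : ℕ) : Finset (Fin n) := {p | i ≤ p ∧ (p : ℕ) < i + j}

@[simp]
lemma mem_block {i : ℕ} {p : Fin n} : p ∈ block n i j ↔ i ≤ p ∧ (p : ℕ) < i + j := by simp [block]

lemma exists_blockEmb_eq_iff {i : ℕ} (h : i + j ≤ n) {p : Fin n} :
    (∃ k, blockEmb h k = p) ↔ p ∈ block n i j := by
  rw [mem_block]
  refine ⟨?_, fun hp => ⟨⟨p - i, by omega⟩, Fin.ext (by simp only [coe_blockEmb]; omega)⟩⟩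
  rintro ⟨k, rfl⟩
  simp

/-- The permutation of the positions of a word of length `n` which acts as `ρ` on the block
`i, …, i + j - 1`. It is the identity if the block does not fit into the word. -/
def blockPerm (i : ℕ) (ρ : Perm (Fin j)) : Perm (Fin n) :=
  if h : i + j ≤ n then ρ.viaFintypeEmbedding (blockEmb h).toEmbedding else 1

lemma blockPerm_blockEmb {i : ℕ} (h : i + j ≤ n) (ρ : Perm (Fin j)) (k : Fin j) :
    blockPerm i ρ (blockEmb h k) = blockEmb h (ρ k) := by
  rw [blockPerm, dif_pos h]
  exact Perm.viaFintypeEmbedding_apply_image ρ (blockEmb h).toEmbedding k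

lemma blockPerm_of_notMem_block {i : ℕ} {ρ : Perm (Fin j)} {p : Fin n} (hp : p ∉ block n i j) :
    blockPerm i ρ p = p := by
  unfold blockPerm
  split_ifs with h
  · exact Perm.viaFintypeEmbedding_apply_notMem_range _ _ (mt (exists_blockEmb_eq_iff h).mp hp)
  · rfl

lemma blockPerm_mem_block {i : ℕ} (h : i + j ≤ n) {ρ : Perm (Fin j)} {p : Fin n} :
    blockPerm i ρ p ∈ block n i j ↔ p ∈ block n i j := by
  by_cases hp : p ∈ block n i j
  · obtain ⟨k, rfl⟩ := (exists_blockEmb_eq_iff h).mpr hp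
    simp [blockPerm_blockEmb h]
  · rw [blockPerm_of_notMem_block hp]

lemma blockPerm_lt_blockPerm_iff {i : ℕ} (h : i + j ≤ n) {ρ : Perm (Fin j)} {p r : Fin n}
    (hpr : ¬ (p ∈ block n i j ∧ r ∈ block n i j)) :
    blockPerm i ρ p < blockPerm i ρ r ↔ p < r := by
  by_cases hp : p ∈ block n i j
  · have hr : r ∉ block n i j := fun hr => hpr ⟨hp, hr⟩
    have hp' := (blockPerm_mem_block h (ρ := ρ)).mpr hp
    rw [blockPerm_of_notMem_block hr]
    simp only [mem_block, Fin.lt_def] at *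
    omega
  · rw [blockPerm_of_notMem_block hp]
    by_cases hr : r ∈ block n i j
    · have hr' := (blockPerm_mem_block h (ρ := ρ)).mpr hr
      simp only [mem_block, Fin.lt_def] at *
      omega
    · rw [blockPerm_of_notMem_block hr]

/-- The permutations of `j` positions fixing the first and the last one; for `ρ` of this kind, `τ`
and `τ * ρ` have the same first and last letters. -/
def FixesEnds (ρ : Perm (Fin j)) : Prop :=
  ∀ k : Fin j, (k : ℕ) = 0 ∨ (k : ℕ) + 1 = j → ρ k = k

lemma fixesEnds_of_mul_apply_eq {τ ρ : Perm (Fin j)} (hj : 0 < j)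
    (hfirst : (τ * ρ) ⟨0, hj⟩ = τ ⟨0, hj⟩)
    (hlast : (τ * ρ) ⟨j - 1, by omega⟩ = τ ⟨j - 1, by omega⟩) : FixesEnds ρ := by
  rintro k (hk | hk)
  · rw [show k = ⟨0, hj⟩ from Fin.ext hk]
    exact τ.injective hfirst
  · rw [show k = ⟨j - 1, by omega⟩ from Fin.ext (by simp only; omega)]
    exact τ.injective hlast

lemma FixesEnds.blockPerm_eq_self {ρ : Perm (Fin j)} (hρ : FixesEnds ρ) {i : ℕ} {p : Fin n}
    (hp : (p : ℕ) ≤ i ∨ i + j ≤ p + 1) : blockPerm i ρ p = p := by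
  by_cases hb : i + j ≤ n ∧ p ∈ block n i j
  · obtain ⟨h, hpb⟩ := hb
    obtain ⟨k, rfl⟩ := (exists_blockEmb_eq_iff h).mpr hpb
    rw [coe_blockEmb] at hp
    rw [blockPerm_blockEmb h, hρ k (by omega)]
  · by_cases h : i + j ≤ n
    · exact blockPerm_of_notMem_block fun hpb => hb ⟨h, hpb⟩
    · rw [blockPerm, dif_neg h, Perm.one_apply]

end Blocks

section Matches

variable {τ ρ : Perm (Fin j)} {σ : Perm (Fin n)} {i : ℕ}

lemma isMatchAt_iff : IsMatchAt τ σ i ↔ ∃ h : i + j ≤ n, ∀ k l,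
    σ (blockEmb h k) < σ (blockEmb h l) ↔ τ k < τ l := by
  refine exists_congr fun h => ⟨fun hred k l => ?_, red_eq_of_lt_iff⟩
  rw [Fin.lt_def (a := τ k), ← hred k, ← hred l, red_lt_red_iff]
  rfl

lemma isMatchAt_mul_blockPerm_iff :
    IsMatchAt (τ * ρ) (σ * blockPerm i ρ) i ↔ IsMatchAt τ σ i := by
  rw [isMatchAt_iff, isMatchAt_iff]
  refine exists_congr fun h => ?_
  simp only [Perm.mul_apply, blockPerm_blockEmb h]
  exact (ρ.surjective.forall₂ (p := fun k l =>
    σ (blockEmb h k) < σ (blockEmb h l) ↔ τ k < τ l)).symm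

lemma FixesEnds.isMatchAt_mul_blockPerm_iff (hρ : FixesEnds ρ) {a : ℕ}
    (ha : i + j ≤ a + 1 ∨ a + j ≤ i + 1) :
    IsMatchAt τ (σ * blockPerm a ρ) i ↔ IsMatchAt τ σ i := by
  rw [isMatchAt_iff, isMatchAt_iff]
  refine exists_congr fun h => ?_
  have hfix (k : Fin j) : blockPerm a ρ (blockEmb h k) = blockEmb h k :=
    hρ.blockPerm_eq_self (by rw [coe_blockEmb]; omega)
  simp only [Perm.mul_apply, hfix]

/-- The permutation order isomorphic to the factor of `σ` in the positions `i, …, i + m - 1`. -/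
def factor (σ : Perm (Fin n)) (h : i + m ≤ n) : Perm (Fin m) :=
  (Tuple.sort (σ ∘ blockEmb h))⁻¹

lemma factor_lt_factor_iff (h : i + m ≤ n) {k l : Fin m} :
    factor σ h k < factor σ h l ↔ σ (blockEmb h k) < σ (blockEmb h l) := by
  set w := σ ∘ blockEmb h
  have hw : Function.Injective w := σ.injective.comp (blockEmb h).injective
  have hsorted : StrictMono (w ∘ Tuple.sort w) :=
    (Tuple.monotone_sort w).strictMono_of_injective (hw.comp (Tuple.sort w).injective)
  rw [← hsorted.lt_iff_lt]
  simp [factor, w]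

lemma isMatchAt_factor_iff (h : i + m ≤ n) {k : ℕ} (hk : k + j ≤ m) :
    IsMatchAt τ (factor σ h) k ↔ IsMatchAt τ σ (i + k) := by
  have hk' : i + k + j ≤ n := by omega
  have hemb (l : Fin j) : blockEmb h (blockEmb hk l) = blockEmb hk' l :=
    Fin.ext (by simp only [coe_blockEmb, add_assoc])
  rw [isMatchAt_iff, isMatchAt_iff, exists_prop_of_true hk, exists_prop_of_true hk']
  simp only [factor_lt_factor_iff, hemb]

lemma mch_factor_eq_two (hj : 0 < j) {d : ℕ} (hd : 0 < d) (h : i + (d + j) ≤ n)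
    (hfirst : IsMatchAt τ σ i) (hsecond : IsMatchAt τ σ (i + d))
    (hbetween : ∀ e, 0 < e → e < d → ¬ IsMatchAt τ σ (i + e)) : mch τ (factor σ h) = 2 := by
  have hpair : {k ∈ range (d + j) | IsMatchAt τ (factor σ h) k} = {0, d} := by
    ext k
    simp only [mem_filter, mem_range, mem_insert, mem_singleton]
    constructor
    · rintro ⟨-, hk⟩
      have hkd := hk.1
      rw [isMatchAt_factor_iff h hkd] at hk
      by_contra! hne
      exact hbetween k (by omega) (by omega) hk
    · rintro (rfl | rfl)
      · exact ⟨by omega, (isMatchAt_factor_iff h (by omega)).mpr hfirst⟩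
      · exact ⟨by omega, (isMatchAt_factor_iff h le_rfl).mpr hsecond⟩
  rw [mch, hpair, card_pair hd.ne]

lemma MinimalOverlapping.add_le_of_lt (hτ : MinimalOverlapping τ) (hi : IsMatchAt τ σ i) {i' : ℕ}
    (hi' : IsMatchAt τ σ i') (hlt : i < i') : i + j ≤ i' + 1 := by
  obtain ⟨hj, -, hmin⟩ := hτ
  induction i' using Nat.strong_induction_on with
  | _ i' ih =>
    by_cases hex : ∃ a, i < a ∧ a < i' ∧ IsMatchAt τ σ a
    · obtain ⟨a, hia, hai', ha⟩ := hex
      have := ih a hai' ha hia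
      omega
    · obtain ⟨d, rfl⟩ := Nat.exists_eq_add_of_lt hlt
      have hn := hi'.1
      have htwo := mch_factor_eq_two (by omega) d.succ_pos (by omega) hi hi'
        fun e he hed hm => hex ⟨i + e, by omega, by omega, hm⟩
      have := hmin ⟨_, htwo⟩
      omega

/-- The blocks of length `j` starting at the positions of `S` pairwise share at most one
position. -/
def AlmostDisjointBlocks (j : ℕ) (S : Finset ℕ) : Prop :=
  (S : Set ℕ).Pairwise fun i i' => i + j ≤ i' + 1 ∨ i' + j ≤ i + 1

lemma MinimalOverlapping.almostDisjointBlocks (hτ : MinimalOverlapping τ) {S : Finset ℕ}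
    (hS : ∀ i ∈ S, IsMatchAt τ σ i) : AlmostDisjointBlocks j S := fun i hi i' hi' hne =>
  hne.lt_or_gt.imp (hτ.add_le_of_lt (hS i hi) (hS i' hi'))
    (hτ.add_le_of_lt (hS i' hi') (hS i hi))

end Matches

section Statistics

variable {τ ρ : Perm (Fin j)} {σ : Perm (Fin n)} {i : ℕ}

lemma mem_desSet {p : Fin n} :
    p ∈ desSet σ ↔ ∃ h : (p : ℕ) + 1 < n, σ ⟨p + 1, h⟩ < σ p := by
  simp [desSet]

lemma IsMatchAt.card_desSet_inter_block (hm : IsMatchAt τ σ i) :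
    #(desSet σ ∩ block n i (j - 1)) = des τ := by
  obtain ⟨h, hlt⟩ := isMatchAt_iff.mp hm
  rw [des, ← card_map (blockEmb h).toEmbedding]
  congr 1
  ext p
  simp only [mem_inter, mem_block, mem_map, mem_desSet, RelEmbedding.coe_toEmbedding]
  constructor
  · rintro ⟨⟨hpn, hdes⟩, hip, hpj⟩
    obtain ⟨k, rfl⟩ := (exists_blockEmb_eq_iff h).mpr (mem_block.mpr ⟨hip, by omega⟩)
    rw [coe_blockEmb] at hpj
    exact ⟨k, ⟨by omega, (hlt ⟨k + 1, by omega⟩ k).mp hdes⟩, rfl⟩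
  · rintro ⟨k, ⟨hkj, hdes⟩, rfl⟩
    have hk := coe_blockEmb h k
    exact ⟨⟨by omega, (hlt ⟨k + 1, hkj⟩ k).mpr hdes⟩, by omega, by omega⟩

lemma IsMatchAt.des_mul_blockPerm (hm : IsMatchAt τ σ i) (hρ : FixesEnds ρ)
    (hdes : des (τ * ρ) = des τ) : des (σ * blockPerm i ρ) = des σ := by
  have hinside := (isMatchAt_mul_blockPerm_iff (ρ := ρ)).mpr hm |>.card_desSet_inter_block
  rw [hdes, ← hm.card_desSet_inter_block] at hinside
  have houtside : desSet (σ * blockPerm i ρ) \ block n i (j - 1) =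
      desSet σ \ block n i (j - 1) := by
    ext p
    simp only [mem_sdiff, mem_block, mem_desSet, Perm.mul_apply]
    refine and_congr_left fun hp => exists_congr fun hpn => ?_
    rw [hρ.blockPerm_eq_self (p := p) (by omega),
      hρ.blockPerm_eq_self (p := ⟨p + 1, hpn⟩) (by simp only; omega)]
  rw [des, ← card_inter_add_card_sdiff, hinside, houtside, card_inter_add_card_sdiff, des]

/-- The set of inversions of `σ`, as pairs of positions. -/
def invSet (σ : Perm (Fin n)) : Finset (Fin n × Fin n) := {p | p.1 < p.2 ∧ σ p.2 < σ p.1}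

lemma mem_invSet {p : Fin n × Fin n} : p ∈ invSet σ ↔ p.1 < p.2 ∧ σ p.2 < σ p.1 := by
  simp [invSet]

lemma inv_eq_card_invSet : inv σ = #(invSet σ) := rfl

lemma IsMatchAt.card_invSet_inter_block (hm : IsMatchAt τ σ i) :
    #(invSet σ ∩ block n i j ×ˢ block n i j) = inv τ := by
  obtain ⟨h, hlt⟩ := isMatchAt_iff.mp hm
  let e := (blockEmb h).toEmbedding
  rw [inv_eq_card_invSet, ← card_map (e.prodMap e)]
  congr 1
  ext ⟨p, r⟩
  simp only [mem_inter, mem_product, mem_map, mem_invSet, ← exists_blockEmb_eq_iff h]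
  constructor
  · rintro ⟨hpr, ⟨k, rfl⟩, l, rfl⟩
    rw [(blockEmb h).lt_iff_lt, hlt] at hpr
    exact ⟨(k, l), hpr, rfl⟩
  · rintro ⟨⟨k, l⟩, hkl, heq⟩
    obtain ⟨rfl, rfl⟩ := Prod.mk.inj heq
    exact ⟨⟨(blockEmb h).lt_iff_lt.mpr hkl.1, (hlt l k).mpr hkl.2⟩, ⟨k, rfl⟩, l, rfl⟩

lemma IsMatchAt.inv_mul_blockPerm (hm : IsMatchAt τ σ i) (hinv : inv (τ * ρ) = inv τ) :
    inv (σ * blockPerm i ρ) = inv σ := by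
  have hinside := (isMatchAt_mul_blockPerm_iff (ρ := ρ)).mpr hm |>.card_invSet_inter_block
  rw [hinv, ← hm.card_invSet_inter_block] at hinside
  let π : Perm (Fin n) := blockPerm i ρ
  have houtside : #(invSet (σ * π) \ block n i j ×ˢ block n i j) =
      #(invSet σ \ block n i j ×ˢ block n i j) := by
    refine card_equiv (π.prodCongr π) fun ⟨p, r⟩ => ?_
    simp only [mem_sdiff, mem_invSet, mem_product, prodCongr_apply, Prod.map, Perm.mul_apply, π,
      blockPerm_mem_block hm.1]
    exact and_congr_left fun hpr => and_congr_left' (blockPerm_lt_blockPerm_iff hm.1 hpr).symm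
  rw [inv_eq_card_invSet, ← card_inter_add_card_sdiff, hinside, houtside,
    card_inter_add_card_sdiff, inv_eq_card_invSet]

end Statistics

section InclusionExclusion

variable {G : Type*} [AddCommGroup G]

/-- The permutations of length `n` having a `τ i`-match at every position `i` of `S`. The pattern
may depend on the position, so that matches can be replaced one at a time. -/
def marked (n : ℕ) (τ : ℕ → Perm (Fin j)) (S : Finset ℕ) : Finset (Perm (Fin n)) :=
  {σ | ∀ i ∈ S, IsMatchAt (τ i) σ i}

lemma mem_marked {τ : ℕ → Perm (Fin j)} {S : Finset ℕ} {σ : Perm (Fin n)} :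
    σ ∈ marked n τ S ↔ ∀ i ∈ S, IsMatchAt (τ i) σ i := by
  simp [marked]

lemma sum_NM_eq_sum_marked (τ : Perm (Fin j)) (w : Perm (Fin n) → G) :
    ∑ σ ∈ NM n τ, w σ =
      ∑ S ∈ (range n).powerset, (-1 : ℤ) ^ #S • ∑ σ ∈ marked n (fun _ => τ) S, w σ := by
  let M (i : ℕ) : Finset (Perm (Fin n)) := {σ | IsMatchAt τ σ i}
  have hNM : NM n τ = (range n).inf fun i => (M i)ᶜ := by
    ext σ
    simp [NM, mch, M, mem_inf, filter_eq_empty_iff]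
  have hmarked (S : Finset ℕ) : marked n (fun _ => τ) S = S.inf M := by
    ext σ
    simp [mem_marked, M, mem_inf]
  simp only [hNM, hmarked, inclusion_exclusion_sum_inf_compl]

variable {w : Perm (Fin n) → G}

lemma sum_marked_update {ρ : Perm (Fin j)} (hρ : FixesEnds ρ) {τ : ℕ → Perm (Fin j)}
    {S : Finset ℕ} (hS : AlmostDisjointBlocks j S) {a : ℕ} (ha : a ∈ S)
    (hw : ∀ σ, IsMatchAt (τ a) σ a → w (σ * blockPerm a ρ) = w σ) :
    ∑ σ ∈ marked n τ S, w σ = ∑ σ ∈ marked n (Function.update τ a (τ a * ρ)) S, w σ := by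
  refine sum_equiv (Equiv.mulRight (blockPerm a ρ)) (fun σ => ?_)
    fun σ hσ => (hw σ (mem_marked.mp hσ a ha)).symm
  simp only [mem_marked, coe_mulRight]
  refine forall₂_congr fun i hi => ?_
  obtain rfl | hia := eq_or_ne i a
  · rw [Function.update_self, isMatchAt_mul_blockPerm_iff]
  · rw [Function.update_of_ne hia, hρ.isMatchAt_mul_blockPerm_iff (hS hi ha hia)]

lemma sum_marked_const_eq {τ ρ : Perm (Fin j)} (hρ : FixesEnds ρ)
    (hw : ∀ σ i, IsMatchAt τ σ i → w (σ * blockPerm i ρ) = w σ) {S : Finset ℕ}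
    (hS : AlmostDisjointBlocks j S) :
    ∑ σ ∈ marked n (fun _ => τ) S, w σ = ∑ σ ∈ marked n (fun _ => τ * ρ) S, w σ := by
  have hpiecewise (T : Finset ℕ) (hT : T ⊆ S) : ∑ σ ∈ marked n (fun _ => τ) S, w σ =
      ∑ σ ∈ marked n (T.piecewise (fun _ => τ * ρ) fun _ => τ) S, w σ := by
    induction T using Finset.induction_on with
    | empty => rw [piecewise_empty]
    | insert a T haT ih =>
      have hτa : T.piecewise (fun _ => τ * ρ) (fun _ => τ) a = τ := piecewise_eq_of_notMem _ _ _ haT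
      rw [ih ((subset_insert a T).trans hT), piecewise_insert,
        sum_marked_update hρ hS (hT (mem_insert_self a T)) (by simpa only [hτa] using (hw · a)),
        hτa]
  rw [hpiecewise S subset_rfl]
  congr 1
  ext σ
  simp +contextual [mem_marked]

lemma MinimalOverlapping.marked_eq_empty {τ : Perm (Fin j)} (hτ : MinimalOverlapping τ)
    {S : Finset ℕ} (hS : ¬ AlmostDisjointBlocks j S) : marked n (fun _ => τ) S = ∅ :=
  eq_empty_of_forall_notMem fun _ hσ => hS (hτ.almostDisjointBlocks (mem_marked.mp hσ))

theorem sum_NM_eq_sum_NM_mul {τ ρ : Perm (Fin j)} (hτ : MinimalOverlapping τ)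
    (hτρ : MinimalOverlapping (τ * ρ)) (hρ : FixesEnds ρ)
    (hw : ∀ σ i, IsMatchAt τ σ i → w (σ * blockPerm i ρ) = w σ) :
    ∑ σ ∈ NM n τ, w σ = ∑ σ ∈ NM n (τ * ρ), w σ := by
  rw [sum_NM_eq_sum_marked, sum_NM_eq_sum_marked]
  refine sum_congr rfl fun S _ => congrArg _ ?_
  by_cases hS : AlmostDisjointBlocks j S
  · exact sum_marked_const_eq hρ hw hS
  · rw [hτ.marked_eq_empty hS, hτρ.marked_eq_empty hS]

end InclusionExclusion

end CWilf

theorem theorem1p6_general {j : ℕ} {α β : Equiv.Perm (Fin j)}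
    (hα : CWilf.MinimalOverlapping α) (hβ : CWilf.MinimalOverlapping β)
    (hfirst : α ⟨0, by have := hα.1; omega⟩ = β ⟨0, by have := hα.1; omega⟩)
    (hlast : α ⟨j - 1, by have := hα.1; omega⟩ = β ⟨j - 1, by have := hα.1; omega⟩)
    (hdes : CWilf.des α = CWilf.des β) :
    (CWilf.desEGF α = CWilf.desEGF β ∧ CWilf.StatCWilfEquiv ![CWilf.desStat] α β) ∧
    (CWilf.inv α = CWilf.inv β →
      CWilf.desInvQEGF α = CWilf.desInvQEGF β ∧
      CWilf.StatCWilfEquiv ![CWilf.desStat, CWilf.invStat] α β) := by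
  obtain ⟨ρ, rfl⟩ : ∃ ρ, β = α * ρ := ⟨α⁻¹ * β, (mul_inv_cancel_left α β).symm⟩
  have hρ : CWilf.FixesEnds ρ := CWilf.fixesEnds_of_mul_apply_eq _ hfirst.symm hlast.symm
  refine ⟨⟨PowerSeries.ext fun n => ?_, fun n _ => ?_⟩,
    fun hinv => ⟨PowerSeries.ext fun n => ?_, fun n _ => ?_⟩⟩
  · simp only [CWilf.desEGF, PowerSeries.coeff_mk]
    exact congrArg _ (CWilf.sum_NM_eq_sum_NM_mul hα hβ hρ fun σ i hm => by
      rw [hm.des_mul_blockPerm hρ hdes.symm])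
  · refine CWilf.sum_NM_eq_sum_NM_mul hα hβ hρ fun σ i hm => ?_
    simp [CWilf.desStat, hm.des_mul_blockPerm hρ hdes.symm]
  · simp only [CWilf.desInvQEGF, PowerSeries.coeff_mk]
    exact congrArg _ (CWilf.sum_NM_eq_sum_NM_mul hα hβ hρ fun σ i hm => by
      rw [hm.des_mul_blockPerm hρ hdes.symm, hm.inv_mul_blockPerm hinv.symm])
  · refine CWilf.sum_NM_eq_sum_NM_mul hα hβ hρ fun σ i hm => ?_
    simp [Fin.prod_univ_two, CWilf.desStat, CWilf.invStat, hm.des_mul_blockPerm hρ hdes.symm,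
      hm.inv_mul_blockPerm hinv.symm]

theorem theorem1p6 {j : ℕ} (hj : 3 ≤ j) (α β : Equiv.Perm (Fin j))
    (hα : CWilf.MinimalOverlapping α) (hβ : CWilf.MinimalOverlapping β)
    (hα1 : α ⟨0, by omega⟩ = ⟨0, by omega⟩) (hβ1 : β ⟨0, by omega⟩ = ⟨0, by omega⟩)
    (hlast : α ⟨j - 1, by omega⟩ = β ⟨j - 1, by omega⟩)
    (hdes : CWilf.des α = CWilf.des β) :
    (CWilf.desEGF α = CWilf.desEGF β ∧ CWilf.StatCWilfEquiv ![CWilf.desStat] α β) ∧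
    (CWilf.inv α = CWilf.inv β →
      CWilf.desInvQEGF α = CWilf.desInvQEGF β ∧
      CWilf.StatCWilfEquiv ![CWilf.desStat, CWilf.invStat] α β) :=
  theorem1p6_general hα hβ (hα1.trans hβ1.symm) hlast hdes
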